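/- There is an absolute constant $C$ such that for all integers $k\ge 3$ and $\delta\ge 1$ and every finite simple connected $k$-colorable graph $G$ of order $n$ and minimum degree at least $\delta$, \[ \operatorname{diam}(G)\le \frac{3k-4}{k-1}\cdot\frac{n}{\delta}+C=\left(3-\frac{1}{k-1}\right)\frac{n}{\delta}+C. \] -/

import Mathlib

/-! Weighted double counting over the distance layers from an end `s` of a diametral pair at
distance `D`. Give layer `i` a probability weight `y i` on the colours occurring in it. A vertex of
colour `c` in layer `i` has at least `δ` neighbours, all in layers `i - 1`, `i`, `i + 1` and of
colour other than `c`. Averaging over `c` and summing over `i ≤ D` gives at least `(D + 1) * δ`,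
while a vertex `u` in layer `j` is counted at most `∑ (1 - y i (col u))` over `i` within 1 of `j`.
The weights are built greedily so that `y (j - 1) + y j ≥ 1 / (k - 1)` on the colours of layer `j`;
hence `u` counts at most `3 - 1 / (k - 1)`. -/

/-- A probability weight `w` on the colours, supported on `A`, some value of which is at least `ε`. -/
structure IsColorWeight {K : Type*} [Fintype K] (ε : ℝ) (A : Finset K) (w : K → ℝ) : Prop where
  nonneg : ∀ c, 0 ≤ w c
  support : ∀ c, c ∉ A → w c = 0
  sum_eq : ∑ c, w c = 1
  exists_le : ∃ c, ε ≤ w c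

/-- On a proper nonempty subset, the uniform weight is at least `1 / (k - 1)` everywhere. -/
theorem exists_isColorWeight_of_ne_univ {K : Type*} [Fintype K] [DecidableEq K]
    {A : Finset K} (hA : A.Nonempty) (hne : A ≠ Finset.univ) :
    ∃ w, IsColorWeight (1 / ((Fintype.card K : ℝ) - 1)) A w ∧
      ∀ c ∈ A, 1 / ((Fintype.card K : ℝ) - 1) ≤ w c := by
  have hpos : (0 : ℝ) < A.card := by exact_mod_cast hA.card_pos
  have hlt : (A.card : ℝ) + 1 ≤ Fintype.card K := by
    exact_mod_cast (Finset.card_lt_iff_ne_univ A).2 hne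
  have hle : 1 / ((Fintype.card K : ℝ) - 1) ≤ 1 / (A.card : ℝ) :=
    one_div_le_one_div_of_le hpos (by linarith)
  have hall : ∀ c ∈ A, 1 / ((Fintype.card K : ℝ) - 1) ≤ if c ∈ A then 1 / (A.card : ℝ) else 0 :=
    fun c hc => by rwa [if_pos hc]
  obtain ⟨a, ha⟩ := hA
  refine ⟨fun c => if c ∈ A then 1 / (A.card : ℝ) else 0, ⟨fun c => ?_, fun c hc => if_neg hc, ?_,
    a, hall a ha⟩, hall⟩
  · split_ifs <;> positivity
  · rw [Finset.sum_ite_mem, Finset.univ_inter, Finset.sum_const, nsmul_eq_mul]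
    field_simp

/-- The weight that is uniform on all colours but one. -/
theorem isColorWeight_univ {K : Type*} [Fintype K] [DecidableEq K]
    (hK : 2 ≤ Fintype.card K) (a : K) :
    IsColorWeight (1 / ((Fintype.card K : ℝ) - 1)) Finset.univ
      (fun c => if c = a then 0 else 1 / ((Fintype.card K : ℝ) - 1)) := by
  have hK' : (2 : ℝ) ≤ Fintype.card K := by exact_mod_cast hK
  have hpos : 0 < (Fintype.card K : ℝ) - 1 := by linarith
  obtain ⟨b, hb⟩ := Fintype.exists_ne_of_one_lt_card (by omega) a
  refine ⟨fun c => ?_, fun c hc => absurd (Finset.mem_univ c) hc, ?_, b, by simp [hb]⟩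
  · split_ifs <;> positivity
  · have h : ∀ c : K, (if c = a then (0 : ℝ) else 1 / ((Fintype.card K : ℝ) - 1)) =
        1 / ((Fintype.card K : ℝ) - 1) - if c = a then 1 / ((Fintype.card K : ℝ) - 1) else 0 :=
      fun c => by split_ifs <;> ring
    rw [Finset.sum_congr rfl fun c _ => h c, Finset.sum_sub_distrib, Finset.sum_const,
      Finset.sum_ite_eq' Finset.univ a, if_pos (Finset.mem_univ a), Finset.card_univ, nsmul_eq_mul]
    field_simp

theorem exists_isColorWeight {K : Type*} [Fintype K] [DecidableEq K]
    (hK : 2 ≤ Fintype.card K) {A : Finset K} (hA : A.Nonempty) :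
    ∃ w, IsColorWeight (1 / ((Fintype.card K : ℝ) - 1)) A w := by
  by_cases hne : A = Finset.univ
  · obtain ⟨a, -⟩ := hA
    exact ⟨_, hne ▸ isColorWeight_univ hK a⟩
  · obtain ⟨w, hw, -⟩ := exists_isColorWeight_of_ne_univ hA hne
    exact ⟨w, hw⟩

/-- A colour weight on `A` is followed by one on `B` such that the two together are at least
`1 / (k - 1)` on every colour of `B`. -/
theorem IsColorWeight.exists_next {K : Type*} [Fintype K] [DecidableEq K]
    (hK : 2 ≤ Fintype.card K) {A B : Finset K} {w : K → ℝ}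
    (hw : IsColorWeight (1 / ((Fintype.card K : ℝ) - 1)) A w) (hB : B.Nonempty) :
    ∃ w', IsColorWeight (1 / ((Fintype.card K : ℝ) - 1)) B w' ∧
      ∀ c ∈ B, 1 / ((Fintype.card K : ℝ) - 1) ≤ w c + w' c := by
  by_cases hne : B = Finset.univ
  · subst hne
    -- The new weight may vanish at `a` because `w` is already large there; `exists_le` is kept as
    -- an invariant for this choice.
    obtain ⟨a, ha⟩ := hw.exists_le
    refine ⟨_, isColorWeight_univ hK a, fun c _ => ?_⟩
    have := hw.nonneg c
    by_cases hca : c = a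
    · subst hca
      simpa using ha
    · rw [if_neg hca]
      linarith
  · obtain ⟨w', hw', hle⟩ := exists_isColorWeight_of_ne_univ hB hne
    exact ⟨w', hw', fun c hc => by linarith [hw.nonneg c, hle c hc]⟩

theorem exists_isColorWeight_seq {K : Type*} [Fintype K] [DecidableEq K]
    (hK : 2 ≤ Fintype.card K) (A : ℕ → Finset K) (hA : ∀ i, (A i).Nonempty) :
    ∃ y : ℕ → K → ℝ, (∀ i, IsColorWeight (1 / ((Fintype.card K : ℝ) - 1)) (A i) (y i)) ∧
      ∀ i, ∀ c ∈ A (i + 1), 1 / ((Fintype.card K : ℝ) - 1) ≤ y i c + y (i + 1) c := by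
  obtain ⟨w₀, h₀⟩ := exists_isColorWeight hK (hA 0)
  choose next hnext hle using fun (i : ℕ) (w : K → ℝ)
    (hw : IsColorWeight (1 / ((Fintype.card K : ℝ) - 1)) (A i) w) => hw.exists_next hK (hA (i + 1))
  let z : ∀ i : ℕ, {w // IsColorWeight (1 / ((Fintype.card K : ℝ) - 1)) (A i) w} := fun i =>
    Nat.rec ⟨w₀, h₀⟩ (fun i w => ⟨next i w.1 w.2, hnext i w.1 w.2⟩) i
  exact ⟨fun i => (z i).1, fun i => (z i).2, fun i c hc => hle i (z i).1 (z i).2 c hc⟩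

theorem SimpleGraph.Connected.exists_dist_eq {V : Type*} {G : SimpleGraph V} (hG : G.Connected)
    (s t : V) {i : ℕ} (hi : i ≤ G.dist s t) : ∃ v, G.dist s v = i := by
  obtain ⟨p, hp⟩ := hG.exists_walk_length_eq_dist s t
  refine ⟨p.getVert i, le_antisymm ?_ ?_⟩
  · exact (SimpleGraph.dist_le (p.take i)).trans (by simp [SimpleGraph.Walk.take_length])
  · have h₁ : G.dist (p.getVert i) t ≤ p.length - i :=
      (SimpleGraph.dist_le (p.drop i)).trans (by simp [SimpleGraph.Walk.drop_length])
    have h₂ := hG.dist_triangle (u := s) (v := p.getVert i) (w := t)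
    omega

/-- At most three terms occur, and the pair `j - 1`, `j` saves `ε`. For `j = 0` that pair is
missing, but only two terms remain and `2 ≤ 3 - ε`. -/
theorem sum_near_le {ε : ℝ} (hε : ε ≤ 1) (S : Finset ℕ) (j : ℕ) (b : ℕ → ℝ)
    (h₀ : ∀ i, 0 ≤ b i) (h₁ : ∀ i, b i ≤ 1)
    (hj : ∀ i, j = i + 1 → b i + b (i + 1) ≤ 2 - ε) :
    ∑ i ∈ S with i ≤ j + 1 ∧ j ≤ i + 1, b i ≤ 3 - ε := by
  have hsub : {i ∈ S | i ≤ j + 1 ∧ j ≤ i + 1} ⊆ Finset.Ico (j - 1) (j + 2) := fun i hi => by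
    simp only [Finset.mem_filter, Finset.mem_Ico] at hi ⊢
    omega
  refine (Finset.sum_le_sum_of_subset_of_nonneg hsub fun i _ _ => h₀ i).trans ?_
  rcases j with _ | j
  · have : Finset.Ico (0 - 1) (0 + 2) = Finset.range 2 := by ext; simp
    rw [this, Finset.sum_range_succ, Finset.sum_range_one]
    linarith [h₁ 0, h₁ 1]
  · rw [Nat.add_sub_cancel, Finset.sum_Ico_eq_sum_range, show j + 1 + 2 - j = 3 by omega,
      Finset.sum_range_succ, Finset.sum_range_succ, Finset.sum_range_one]
    linarith [hj j rfl, h₁ (j + 2), show b (j + 0) = b j from rfl]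

/-- A graph whose distance layers from `s` are all nonempty up to the `D`-th one, with a proper
colouring in `K`, has many vertices. -/
theorem SimpleGraph.Coloring.mul_le_card {V K : Type*} [Fintype V] [Fintype K] [DecidableEq K]
    {G : SimpleGraph V} [DecidableRel G.Adj] (col : G.Coloring K) (hK : 2 ≤ Fintype.card K)
    (hG : G.Connected) {δ : ℕ} (hδ : δ ≤ G.minDegree) (s t : V) :
    ((G.dist s t : ℝ) + 1) * δ ≤ (3 - 1 / ((Fintype.card K : ℝ) - 1)) * Fintype.card V := by
  classical
  set D := G.dist s t
  have hK' : (2 : ℝ) ≤ Fintype.card K := by exact_mod_cast hK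
  have hε : 1 / ((Fintype.card K : ℝ) - 1) ≤ 1 := by
    rw [div_le_one (by linarith)]
    linarith
  -- Beyond `D` the condition is vacuous and `A i` is everything, so that no `A i` is empty.
  let A : ℕ → Finset K := fun i => {c | i ≤ D → ∃ v, G.dist s v = i ∧ col v = c}
  have hA : ∀ i, (A i).Nonempty := fun i => by
    by_cases hi : i ≤ D
    · obtain ⟨v, hv⟩ := hG.exists_dist_eq s t hi
      exact ⟨col v, by simpa [A] using fun _ => ⟨v, hv, rfl⟩⟩
    · exact ⟨col s, by simp [A, hi]⟩
  obtain ⟨y, hy, hyA⟩ := exists_isColorWeight_seq hK A hA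
  have hmem : ∀ v, col v ∈ A (G.dist s v) := fun v => by
    simpa [A] using fun _ => ⟨v, rfl, rfl⟩
  have hother : ∀ i c, ∑ c' with c' ≠ c, y i c' = 1 - y i c := fun i c => by
    rw [← (hy i).sum_eq, Finset.filter_ne', ← Finset.sum_erase_add _ _ (Finset.mem_univ c)]
    ring
  have hsee : ∀ i ∈ Finset.range (D + 1), ∀ c, y i c * δ ≤
      ∑ u, if (i ≤ G.dist s u + 1 ∧ G.dist s u ≤ i + 1) ∧ c ≠ col u then y i c else 0 := by
    intro i hi c
    by_cases hc : c ∈ A i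
    · obtain ⟨v, hv, rfl⟩ := (Finset.mem_filter.1 hc).2 (Nat.lt_succ_iff.1 (Finset.mem_range.1 hi))
      rw [← Finset.sum_filter, Finset.sum_const, nsmul_eq_mul, mul_comm]
      refine mul_le_mul_of_nonneg_right ?_ ((hy i).nonneg _)
      have hsub : G.neighborFinset v ⊆ Finset.univ.filter fun u =>
          (i ≤ G.dist s u + 1 ∧ G.dist s u ≤ i + 1) ∧ col v ≠ col u := fun u hu => by
        have huv : G.Adj v u := by simpa using hu
        have h₁ := hG.dist_triangle (u := s) (v := v) (w := u)
        have h₂ := hG.dist_triangle (u := s) (v := u) (w := v)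
        rw [SimpleGraph.dist_eq_one_iff_adj.2 huv] at h₁
        rw [SimpleGraph.dist_eq_one_iff_adj.2 huv.symm] at h₂
        simp only [Finset.mem_filter, Finset.mem_univ, true_and]
        exact ⟨⟨by omega, by omega⟩, col.valid huv⟩
      exact_mod_cast (hδ.trans (G.minDegree_le_degree v)).trans (Finset.card_le_card hsub)
    · rw [(hy i).support c hc]
      simp
  have hseen : ∀ u, (∑ i ∈ Finset.range (D + 1), ∑ c,
      if (i ≤ G.dist s u + 1 ∧ G.dist s u ≤ i + 1) ∧ c ≠ col u then y i c else 0) ≤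
        3 - 1 / ((Fintype.card K : ℝ) - 1) := by
    intro u
    have hle : ∀ i, y i (col u) ≤ 1 := fun i => (hy i).sum_eq ▸
      Finset.single_le_sum (fun c _ => (hy i).nonneg c) (Finset.mem_univ (col u))
    have h := sum_near_le hε (Finset.range (D + 1)) (G.dist s u) (fun i => 1 - y i (col u))
      (fun i => by linarith [hle i]) (fun i => by linarith [(hy i).nonneg (col u)])
      (fun i hi => by linarith [hyA i (col u) (hi ▸ hmem u)])
    rw [Finset.sum_filter] at h
    refine le_of_eq_of_le (Finset.sum_congr rfl fun i _ => ?_) h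
    by_cases hi : i ≤ G.dist s u + 1 ∧ G.dist s u ≤ i + 1
    · simp only [hi, true_and, if_true, and_self]
      rw [← Finset.sum_filter, hother]
    · simp only [hi, false_and, if_false, Finset.sum_const_zero]
  calc ((D : ℝ) + 1) * δ = ∑ i ∈ Finset.range (D + 1), ∑ c, y i c * δ := by
        simp_rw [← Finset.sum_mul, (hy _).sum_eq]
        simp
    _ ≤ ∑ i ∈ Finset.range (D + 1), ∑ c, ∑ u,
          if (i ≤ G.dist s u + 1 ∧ G.dist s u ≤ i + 1) ∧ c ≠ col u then y i c else 0 :=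
        Finset.sum_le_sum fun i hi => Finset.sum_le_sum fun c _ => hsee i hi c
    _ = ∑ u, ∑ i ∈ Finset.range (D + 1), ∑ c,
          if (i ≤ G.dist s u + 1 ∧ G.dist s u ≤ i + 1) ∧ c ≠ col u then y i c else 0 := by
        rw [Finset.sum_comm (s := Finset.univ (α := V))]
        exact Finset.sum_congr rfl fun i _ => Finset.sum_comm
    _ ≤ ∑ _u : V, (3 - 1 / ((Fintype.card K : ℝ) - 1)) := Finset.sum_le_sum fun u _ => hseen u
    _ = (3 - 1 / ((Fintype.card K : ℝ) - 1)) * Fintype.card V := by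
        rw [Finset.sum_const, Finset.card_univ, nsmul_eq_mul, mul_comm]

theorem mainTheorem2 :
    ∃ C : ℝ, ∀ k : ℕ, 3 ≤ k → ∀ δ : ℕ, 1 ≤ δ →
      ∀ (V : Type*) [Fintype V] (G : SimpleGraph V) [DecidableRel G.Adj],
        G.Connected → G.Colorable k → δ ≤ G.minDegree →
          (G.diam : ℝ) ≤
              ((3 * (k : ℝ) - 4) / ((k : ℝ) - 1)) * ((Fintype.card V : ℝ) / (δ : ℝ)) + C ∧
          (G.diam : ℝ) ≤
              (3 - 1 / ((k : ℝ) - 1)) * ((Fintype.card V : ℝ) / (δ : ℝ)) + C ∧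
          (3 * (k : ℝ) - 4) / ((k : ℝ) - 1) = 3 - 1 / ((k : ℝ) - 1) := by
  -- `C = 0` suffices, since the count even bounds `diam + 1`.
  refine ⟨0, fun k hk δ hδ V _ G _ hG ⟨col⟩ hmin => ?_⟩
  have hk' : (3 : ℝ) ≤ k := by exact_mod_cast hk
  have hδ' : (0 : ℝ) < δ := by exact_mod_cast hδ
  have heq : (3 * (k : ℝ) - 4) / ((k : ℝ) - 1) = 3 - 1 / ((k : ℝ) - 1) := by
    have : (k : ℝ) - 1 ≠ 0 := by linarith
    field_simp
    ring
  have := hG.nonempty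
  obtain ⟨s, t, hst⟩ := G.exists_dist_eq_diam
  have h := col.mul_le_card (by rw [Fintype.card_fin]; omega) hG hmin s t
  rw [hst, Fintype.card_fin] at h
  have hbound : (G.diam : ℝ) ≤ (3 - 1 / ((k : ℝ) - 1)) * ((Fintype.card V : ℝ) / δ) + 0 := by
    rw [add_zero, ← mul_div_assoc, le_div_iff₀ hδ']
    linarith
  exact ⟨heq ▸ hbound, hbound, heq⟩
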